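/- Let $S\subset\mathbb R^3$ be a regular surface of class $C^2$ (without boundary), that is, $S=f(M)$ where $M$ is a two-dimensional $C^2$ manifold without boundary and $f:M\to\mathbb R^3$ is a $C^2$ map whose differential $df_m$ is injective at every $m\in M$. (Embedded surfaces $S\subset\mathbb R^3$ are the case where $M=S$ and $f$ is the inclusion; regular parametrized surfaces are the case where $M$ is an open subset of $\mathbb R^2$.) Suppose that $S$ is developable, i.e. that its Gaussian curvature $K=\det \mathrm{II}/\det \mathrm{I}$ (the quotient of the determinants of the second and the first fundamental form) vanishes at every point. Then for every point $x=f(m)$ of $S$ and every $\varepsilon>0$ there is a point $x_0\in S$ with $0<|x-x_0|<\varepsilon$ that lies in the tangent plane $x+df_m(\mathbb R^2)$ of $S$ at $x$ (if several points $m$ have the same image $x$, this holds for the tangent plane belonging to each of them). -/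

import Mathlib

open scoped Manifold ContDiff InnerProductSpace

noncomputable section

/-- The parameter plane `ℝ²`. -/
abbrev Plane : Type := EuclideanSpace ℝ (Fin 2)

/-- Euclidean space `ℝ³`. -/
abbrev Space : Type := EuclideanSpace ℝ (Fin 3)

/-- The cross product on Euclidean space `ℝ³`. -/
def cross (a b : Space) : Space :=
  WithLp.toLp 2 (crossProduct (WithLp.ofLp a) (WithLp.ofLp b))

namespace Param

/-- The first partial derivative `∂ᵢ r` of a parametrization. -/
def d1 (r : Plane → Space) (i : Fin 2) (q : Plane) : Space :=
  fderiv ℝ r q (EuclideanSpace.single i 1)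

/-- The second partial derivative `∂ᵢ ∂ⱼ r` of a parametrization. -/
def d2 (r : Plane → Space) (i j : Fin 2) (q : Plane) : Space :=
  fderiv ℝ (d1 r j) q (EuclideanSpace.single i 1)

/-- The unit normal `(∂₀ r × ∂₁ r) / |∂₀ r × ∂₁ r|`. -/
def unitNormal (r : Plane → Space) (q : Plane) : Space :=
  ‖cross (d1 r 0 q) (d1 r 1 q)‖⁻¹ • cross (d1 r 0 q) (d1 r 1 q)

/-- The matrix of the first fundamental form. -/
def firstForm (r : Plane → Space) (q : Plane) : Matrix (Fin 2) (Fin 2) ℝ :=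
  Matrix.of fun i j => ⟪d1 r i q, d1 r j q⟫_ℝ

/-- The matrix of the second fundamental form. -/
def secondForm (r : Plane → Space) (q : Plane) : Matrix (Fin 2) (Fin 2) ℝ :=
  Matrix.of fun i j => ⟪d2 r i j q, unitNormal r q⟫_ℝ

/-- The Gaussian curvature `det II / det I` of a regular parametrized surface. -/
def gaussianCurvature (r : Plane → Space) (q : Plane) : ℝ :=
  (secondForm r q).det / (firstForm r q).det

end Param

section Surface

variable {M : Type*} [TopologicalSpace M] [ChartedSpace Plane M]

/-- The differential at `m` of a map `f : M → ℝ³`, as a linear map from `ℝ²` to `ℝ³`. -/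
def differential (f : M → Space) (m : M) : Plane →L[ℝ] Space :=
  mfderiv (𝓡 2) 𝓘(ℝ, Space) f m

/-- `f : M → ℝ³` is a regular surface of class `C²`: a `C²` map whose differential is injective
at every point. Embedded surfaces `S ⊆ ℝ³` are the case of an inclusion `S → ℝ³`, and
parametrized surfaces the case of an open set `M` of `ℝ²`. -/
structure IsRegularSurface (f : M → Space) : Prop where
  contMDiff : ContMDiff (𝓡 2) 𝓘(ℝ, Space) 2 f
  injective_differential : ∀ m : M, Function.Injective (differential f m)

/-- The Gaussian curvature at `m` of the surface `f : M → ℝ³`, computed in the local coordinates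
given by a chart `e` around `m`. For a regular surface it does not depend on the chart. -/
def gaussianCurvatureInChart (f : M → Space) (e : OpenPartialHomeomorph M Plane) (m : M) : ℝ :=
  Param.gaussianCurvature (f ∘ e.symm) (e m)

/-- A developable surface: a regular surface whose Gaussian curvature vanishes everywhere. -/
structure IsDevelopable (f : M → Space) : Prop extends IsRegularSurface f where
  curvature_eq_zero : ∀ m : M, ∀ e ∈ atlas Plane M, m ∈ e.source →
    gaussianCurvatureInChart f e m = 0

/-- The tangent plane at `m` of the surface `f : M → ℝ³`, as an affine subspace of `ℝ³`: the
plane through `f m` whose direction is the range of the differential of `f` at `m`. -/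
def tangentPlane (f : M → Space) (m : M) : AffineSubspace ℝ Space :=
  AffineSubspace.mk' (f m) (differential f m).range

end Surface

end

/-!
Around a given point the surface is described in a chart by a regular parametrization `r`, with
`r q₀` the point. Let `n = ∂₀ r × ∂₁ r` be its normal field. The theorem follows once, for every
`N : ℝ³`, the height function `q ↦ ⟪r q - r q₀, N⟫` has a zero on each small circle about `q₀`
(`Param.exists_mem_sphere_inner_eq_zero`): with `N = n q₀`, a zero of the height is a point of the
surface in the tangent plane, and it differs from the given point because an immersion does not
take the value `r q₀` again near `q₀`.

If there is no zero on some circle, then the height has a constant sign there, say positive, after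
replacing `N` by `-N` if necessary. By compactness the height function in any direction `x` near `N`
is positive on the circle as well, and being zero at `q₀`, it has a minimum inside the disc. At
this minimum `x` is normal to the surface. Hence the cone `{t • n q}` of the normals over the disc
contains a ball about `N` (`Param.exists_eq_smul_normal_of_pos_on_sphere`).

On the other hand, where the curvature vanishes, the second fundamental form has a nonzero kernel
vector `v`, and the derivative of `n` along `v` is a multiple of `n`. So the derivative of
`(q, t) ↦ t • n q`, a map between spaces of dimension three, is nowhere invertible, and by Sard's
lemma its image is a null set (`Param.volume_normal_cone_eq_zero`). This is a contradiction. Only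
one derivative of `n` is used, so class `C²` is enough.
-/

open Metric MeasureTheory Filter Topology

/-! ### The cross product on Euclidean space -/

section Cross

lemma inner_eq_sum_three (a b : Space) : ⟪a, b⟫_ℝ = a 0 * b 0 + a 1 * b 1 + a 2 * b 2 := by
  simp [PiLp.inner_apply, Fin.sum_univ_three, mul_comm]

lemma cross_zero_coord (a b : Space) : cross a b 0 = a 1 * b 2 - a 2 * b 1 := by
  simp [cross, cross_apply]

lemma cross_one_coord (a b : Space) : cross a b 1 = a 2 * b 0 - a 0 * b 2 := by
  simp [cross, cross_apply]

lemma cross_two_coord (a b : Space) : cross a b 2 = a 0 * b 1 - a 1 * b 0 := by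
  simp [cross, cross_apply]

lemma inner_cross_left (a b : Space) : ⟪cross a b, a⟫_ℝ = 0 := by
  rw [inner_eq_sum_three, cross_zero_coord, cross_one_coord, cross_two_coord]; ring

lemma inner_cross_right (a b : Space) : ⟪cross a b, b⟫_ℝ = 0 := by
  rw [inner_eq_sum_three, cross_zero_coord, cross_one_coord, cross_two_coord]; ring

lemma inner_cross_self (a b : Space) :
    ⟪cross a b, cross a b⟫_ℝ = ⟪a, a⟫_ℝ * ⟪b, b⟫_ℝ - ⟪a, b⟫_ℝ * ⟪b, a⟫_ℝ := by
  simp only [inner_eq_sum_three, cross_zero_coord, cross_one_coord, cross_two_coord]; ring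

/-- A vector orthogonal to `a` and `b` is a multiple of `c = a × b`: the products with `a` and `b`
being zero, `c × x` vanishes, so `|c|² x = ⟪c, x⟫ c`. -/
lemma exists_eq_smul_cross {a b x : Space} (hc : cross a b ≠ 0) (ha : ⟪x, a⟫_ℝ = 0)
    (hb : ⟪x, b⟫_ℝ = 0) : ∃ t : ℝ, x = t • cross a b := by
  have hcc : ⟪cross a b, cross a b⟫_ℝ ≠ 0 := inner_self_ne_zero.2 hc
  have key : ⟪cross a b, cross a b⟫_ℝ • x = ⟪cross a b, x⟫_ℝ • cross a b := by
    simp only [inner_eq_sum_three] at ha hb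
    simp only [inner_eq_sum_three, cross_zero_coord, cross_one_coord, cross_two_coord]
    ext i
    fin_cases i
    all_goals simp [cross_zero_coord, cross_one_coord, cross_two_coord]
    · linear_combination (b 1 * (a 0 * b 1 - a 1 * b 0) - b 2 * (a 2 * b 0 - a 0 * b 2)) * ha -
        (a 1 * (a 0 * b 1 - a 1 * b 0) - a 2 * (a 2 * b 0 - a 0 * b 2)) * hb
    · linear_combination (b 2 * (a 1 * b 2 - a 2 * b 1) - b 0 * (a 0 * b 1 - a 1 * b 0)) * ha -
        (a 2 * (a 1 * b 2 - a 2 * b 1) - a 0 * (a 0 * b 1 - a 1 * b 0)) * hb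
    · linear_combination (b 0 * (a 2 * b 0 - a 0 * b 2) - b 1 * (a 1 * b 2 - a 2 * b 1)) * ha -
        (a 0 * (a 2 * b 0 - a 0 * b 2) - a 1 * (a 1 * b 2 - a 2 * b 1)) * hb
  refine ⟨(⟪cross a b, cross a b⟫_ℝ)⁻¹ * ⟪cross a b, x⟫_ℝ, ?_⟩
  rw [mul_smul, ← key, inv_smul_smul₀ hcc]

/-- A vector `x` orthogonal to `c = a × b` lies in the span of `a` and `b`, since
`|c|² x = (c × x) × c`, and a triple product with `a × b` is a combination of `a` and `b`. -/
lemma exists_eq_add_smul_of_inner_cross {a b x : Space} (hc : cross a b ≠ 0)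
    (hx : ⟪cross a b, x⟫_ℝ = 0) : ∃ s t : ℝ, x = s • a + t • b := by
  have hcc : ⟪cross a b, cross a b⟫_ℝ ≠ 0 := inner_self_ne_zero.2 hc
  have key : ⟪cross a b, cross a b⟫_ℝ • x =
      ⟪cross (cross a b) x, b⟫_ℝ • a + (-⟪cross (cross a b) x, a⟫_ℝ) • b := by
    simp only [inner_eq_sum_three, cross_zero_coord, cross_one_coord, cross_two_coord] at hx
    simp only [inner_eq_sum_three, cross_zero_coord, cross_one_coord, cross_two_coord]
    ext i
    fin_cases i
    all_goals simp
    · linear_combination (a 1 * b 2 - a 2 * b 1) * hx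
    · linear_combination (a 2 * b 0 - a 0 * b 2) * hx
    · linear_combination (a 0 * b 1 - a 1 * b 0) * hx
  refine ⟨(⟪cross a b, cross a b⟫_ℝ)⁻¹ * ⟪cross (cross a b) x, b⟫_ℝ,
    (⟪cross a b, cross a b⟫_ℝ)⁻¹ * (-⟪cross (cross a b) x, a⟫_ℝ), ?_⟩
  rw [mul_smul, mul_smul, ← smul_add, ← key, inv_smul_smul₀ hcc]

lemma DifferentiableAt.cross {E : Type*} [NormedAddCommGroup E] [NormedSpace ℝ E]
    {f g : E → Space} {x : E} (hf : DifferentiableAt ℝ f x) (hg : DifferentiableAt ℝ g x) :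
    DifferentiableAt ℝ (fun y => cross (f y) (g y)) x := by
  rw [differentiableAt_euclidean] at hf hg ⊢
  intro i
  have h0 := hf 0
  have h1 := hf 1
  have h2 := hf 2
  have k0 := hg 0
  have k1 := hg 1
  have k2 := hg 2
  fin_cases i
  all_goals simp [cross_zero_coord, cross_one_coord, cross_two_coord]
  all_goals fun_prop

lemma continuous_cross : Continuous fun p : Space × Space => cross p.1 p.2 := by
  refine (PiLp.continuous_toLp 2 _).comp (continuous_pi fun i => ?_)
  fin_cases i
  all_goals simp [cross_apply]
  all_goals fun_prop

end Cross

/-! ### Normals of a parametrized surface -/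

namespace Param

/-- The normal vector field `∂₀ r × ∂₁ r` of a parametrization, not normalized. -/
noncomputable def normal (r : Plane → Space) (q : Plane) : Space := cross (d1 r 0 q) (d1 r 1 q)

lemma fderiv_apply_eq (r : Plane → Space) (q v : Plane) :
    fderiv ℝ r q v = v 0 • d1 r 0 q + v 1 • d1 r 1 q := by
  have hv : v = v 0 • EuclideanSpace.single (0 : Fin 2) (1 : ℝ) +
      v 1 • EuclideanSpace.single (1 : Fin 2) (1 : ℝ) := by
    ext i; fin_cases i <;> simp
  conv_lhs => rw [hv]
  simp [d1]

lemma fderiv_d1_apply_eq (r : Plane → Space) (j : Fin 2) (q v : Plane) :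
    fderiv ℝ (d1 r j) q v = v 0 • d2 r 0 j q + v 1 • d2 r 1 j q :=
  fderiv_apply_eq (d1 r j) q v

lemma inner_normal_d1 (r : Plane → Space) (j : Fin 2) (q : Plane) :
    ⟪normal r q, d1 r j q⟫_ℝ = 0 := by
  fin_cases j
  · exact inner_cross_left _ _
  · exact inner_cross_right _ _

lemma normal_ne_zero {r : Plane → Space} {q : Plane}
    (h : Function.Injective (fderiv ℝ r q)) : normal r q ≠ 0 := by
  intro h0
  have hli : LinearIndependent ℝ ![d1 r 0 q, d1 r 1 q] := by
    rw [LinearIndependent.pair_iff]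
    intro s t hst
    have : fderiv ℝ r q !₂[s, t] = fderiv ℝ r q 0 := by
      rw [fderiv_apply_eq, map_zero]; simpa using hst
    have h2 := h this
    exact ⟨by simpa using congrArg (· 0) h2, by simpa using congrArg (· 1) h2⟩
  have hli' := hli.map' (WithLp.linearEquiv 2 ℝ (Fin 3 → ℝ)).toLinearMap (LinearEquiv.ker _)
  have h3 : crossProduct (WithLp.ofLp (d1 r 0 q)) (WithLp.ofLp (d1 r 1 q)) ≠ 0 := by
    rw [crossProduct_ne_zero_iff_linearIndependent]
    have hcoe : ![WithLp.ofLp (d1 r 0 q), WithLp.ofLp (d1 r 1 q)] =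
        (WithLp.linearEquiv 2 ℝ (Fin 3 → ℝ)).toLinearMap ∘ ![d1 r 0 q, d1 r 1 q] := by
      ext i; fin_cases i <;> rfl
    rw [hcoe]
    exact hli'
  exact h3 (congrArg WithLp.ofLp h0)

lemma secondForm_det_eq_zero {r : Plane → Space} {q : Plane} (hc : normal r q ≠ 0)
    (hK : gaussianCurvature r q = 0) : (secondForm r q).det = 0 := by
  refine (div_eq_zero_iff.1 hK).resolve_right ?_
  have h := inner_cross_self (d1 r 0 q) (d1 r 1 q)
  rw [Matrix.det_fin_two]
  simp only [firstForm, Matrix.of_apply]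
  rw [← h]
  exact inner_self_ne_zero.2 hc

/-- If the curvature vanishes, the second fundamental form has a kernel vector `v ≠ 0`, and the
derivative of the normal field along `v` is again normal: its product with `∂ⱼ r` is minus that of
the normal with `∂ᵥ ∂ⱼ r`. -/
lemma exists_fderiv_normal_eq_smul {r : Plane → Space} {q : Plane}
    (hd : ∀ j, DifferentiableAt ℝ (d1 r j) q) (hc : normal r q ≠ 0)
    (hK : gaussianCurvature r q = 0) :
    ∃ v : Plane, v ≠ 0 ∧ ∃ t : ℝ, fderiv ℝ (normal r) q v = t • normal r q := by
  obtain ⟨w, hw, hwII⟩ := Matrix.exists_vecMul_eq_zero_iff.2 (secondForm_det_eq_zero hc hK)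
  refine ⟨WithLp.toLp 2 w, fun h => hw (congrArg WithLp.ofLp h), ?_⟩
  have hperp (j : Fin 2) : ⟪fderiv ℝ (normal r) q (WithLp.toLp 2 w), d1 r j q⟫_ℝ = 0 := by
    have hn : DifferentiableAt ℝ (normal r) q := (hd 0).cross (hd 1)
    have h1 := fderiv_inner_apply ℝ hn (hd j) (WithLp.toLp 2 w)
    simp only [inner_normal_d1] at h1
    have h2 : ⟪normal r q, fderiv ℝ (d1 r j) q (WithLp.toLp 2 w)⟫_ℝ = 0 := by
      have h3 := congrFun hwII j
      simp only [Matrix.vecMul, dotProduct, Fin.sum_univ_two, secondForm, Matrix.of_apply,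
        unitNormal, inner_smul_right, Pi.zero_apply] at h3
      rw [fderiv_d1_apply_eq, inner_add_right, inner_smul_right, inner_smul_right]
      have h4 : ‖normal r q‖⁻¹ ≠ 0 := inv_ne_zero (norm_ne_zero_iff.2 hc)
      apply (mul_eq_zero.1 _).resolve_left h4
      rw [real_inner_comm, real_inner_comm (d2 r 1 j q)]
      simp only [normal]
      linear_combination h3
    simpa [h2] using h1.symm
  exact exists_eq_smul_cross hc (hperp 0) (hperp 1)

/-- By Sard's lemma, the normal directions of a surface of vanishing curvature, as a cone in `ℝ³`,
form a null set. -/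
lemma volume_normal_cone_eq_zero {r : Plane → Space} {s : Set Plane}
    (hd : ∀ q ∈ s, ∀ j, DifferentiableAt ℝ (d1 r j) q) (hc : ∀ q ∈ s, normal r q ≠ 0)
    (hK : ∀ q ∈ s, gaussianCurvature r q = 0) :
    volume {x : Space | ∃ q ∈ s, ∃ t : ℝ, x = t • normal r q} = 0 := by
  -- Sard's lemma needs equal domain and codomain: identify `ℝ³` with `ℝ² × ℝ`.
  have hdim : Module.finrank ℝ Space = Module.finrank ℝ (Plane × ℝ) := by simp
  let L : Space ≃L[ℝ] Plane × ℝ := ContinuousLinearEquiv.ofFinrankEq hdim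
  let F : Space → Space := fun y => (L y).2 • normal r (L y).1
  have hF : ∀ y ∈ {y | (L y).1 ∈ s}, HasFDerivAt F
      (fderiv ℝ F y) y ∧ ∀ z, fderiv ℝ F y z =
        (L y).2 • fderiv ℝ (normal r) (L y).1 (L z).1 + (L z).2 • normal r (L y).1 := by
    intro y hy
    have hn : HasFDerivAt (normal r) (fderiv ℝ (normal r) (L y).1) (L y).1 :=
      ((hd _ hy 0).cross (hd _ hy 1)).hasFDerivAt
    have h1 : HasFDerivAt (fun y => (L y).1) ((ContinuousLinearMap.fst ℝ Plane ℝ).comp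
        (L : Space →L[ℝ] Plane × ℝ)) y :=
      ((ContinuousLinearMap.fst ℝ Plane ℝ).comp (L : Space →L[ℝ] Plane × ℝ)).hasFDerivAt
    have h2 : HasFDerivAt (fun y => (L y).2) ((ContinuousLinearMap.snd ℝ Plane ℝ).comp
        (L : Space →L[ℝ] Plane × ℝ)) y :=
      ((ContinuousLinearMap.snd ℝ Plane ℝ).comp (L : Space →L[ℝ] Plane × ℝ)).hasFDerivAt
    have h3 := h2.smul (hn.comp y h1)
    have h4 : HasFDerivAt F _ y := h3
    refine ⟨h4.differentiableAt.hasFDerivAt, fun z => ?_⟩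
    rw [h4.fderiv]
    simp
  refine measure_mono_null ?_ (addHaar_image_eq_zero_of_det_fderivWithin_eq_zero volume
    (f := F) (f' := fderiv ℝ F) (s := {y | (L y).1 ∈ s})
    (fun y hy => (hF y hy).1.hasFDerivWithinAt) fun y hy => ?_)
  · rintro x ⟨q, hq, t, rfl⟩
    exact ⟨L.symm (q, t), by simpa using hq, by simp [F]⟩
  · obtain ⟨v, hv, t, ht⟩ := exists_fderiv_normal_eq_smul (hd _ hy) (hc _ hy) (hK _ hy)
    rw [ContinuousLinearMap.det, LinearMap.det_eq_zero_iff_ker_ne_bot, Submodule.ne_bot_iff]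
    -- The radial part of the cone absorbs the derivative in the direction `v`.
    refine ⟨L.symm (v, -((L y).2 * t)), ?_, ?_⟩
    · rw [LinearMap.mem_ker, ContinuousLinearMap.coe_coe, (hF y hy).2]
      simp [ht, smul_smul]
    · simpa using fun h : v = 0 => absurd h hv

/-! ### Zeros of height functions -/

/-- A height function that is positive on a circle stays so for all nearby directions `x`, so each
of these has an interior minimum of its height function, where `x` is normal to the surface. -/
lemma exists_eq_smul_normal_of_pos_on_sphere {r : Plane → Space} {q₀ : Plane} {ρ : ℝ} (hρ : 0 < ρ)
    (hr : ∀ q ∈ closedBall q₀ ρ, DifferentiableAt ℝ r q)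
    (hc : ∀ q ∈ closedBall q₀ ρ, normal r q ≠ 0) {N : Space}
    (hN : ∀ q ∈ sphere q₀ ρ, 0 < ⟪r q - r q₀, N⟫_ℝ) :
    ∃ δ > 0, ∀ x ∈ ball N δ, ∃ q ∈ closedBall q₀ ρ, ∃ t : ℝ, x = t • normal r q := by
  have hcont : ContinuousOn r (closedBall q₀ ρ) := fun q hq =>
    (hr q hq).continuousAt.continuousWithinAt
  have hev : ∀ᶠ x in 𝓝 N, ∀ q ∈ sphere q₀ ρ, 0 < ⟪r q - r q₀, x⟫_ℝ := by
    obtain ⟨B, hB⟩ := (isCompact_closedBall q₀ ρ).exists_bound_of_continuousOn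
      (f := fun q => r q - r q₀) (hcont.sub continuousOn_const)
    have hB0 : 0 ≤ B := (norm_nonneg _).trans (hB q₀ (mem_closedBall_self hρ.le))
    have hne : (sphere q₀ ρ).Nonempty := NormedSpace.sphere_nonempty.2 hρ.le
    obtain ⟨p, hp, hmin⟩ := (isCompact_sphere q₀ ρ).exists_isMinOn hne
      (f := fun q => ⟪r q - r q₀, N⟫_ℝ)
      (((hcont.mono sphere_subset_closedBall).sub continuousOn_const).inner continuousOn_const)
    have hm := hN p hp
    filter_upwards [ball_mem_nhds N (div_pos hm (by linarith : 0 < B + 1))] with x hx q hq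
    rw [mem_ball, dist_eq_norm, lt_div_iff₀ (by linarith)] at hx
    have h1 : ⟪r q - r q₀, x⟫_ℝ = ⟪r q - r q₀, N⟫_ℝ + ⟪r q - r q₀, x - N⟫_ℝ := by
      rw [inner_sub_right]; ring
    have h2 := neg_le_of_abs_le (abs_real_inner_le_norm (r q - r q₀) (x - N))
    have h3 := mul_le_mul_of_nonneg_right (hB q (sphere_subset_closedBall hq)) (norm_nonneg (x - N))
    have h4 : ⟪r p - r q₀, N⟫_ℝ ≤ ⟪r q - r q₀, N⟫_ℝ := hmin hq
    have h5 := norm_nonneg (x - N)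
    nlinarith
  obtain ⟨δ, hδ, hball⟩ := Metric.eventually_nhds_iff_ball.1 hev
  refine ⟨δ, hδ, fun x hx => ?_⟩
  obtain ⟨q, hq, hmin⟩ := (isCompact_closedBall q₀ ρ).exists_isLocalMin_mem_open
    (f := fun q => ⟪r q - r q₀, x⟫_ℝ) (s := ball q₀ ρ) ball_subset_closedBall
    ((hcont.sub continuousOn_const).inner continuousOn_const) (mem_closedBall_self hρ.le)
    (fun z hz => by
      rw [closedBall_sdiff_ball] at hz
      simpa using hball x hx z hz) isOpen_ball
  have hq' := ball_subset_closedBall hq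
  have hperp (j : Fin 2) : ⟪x, d1 r j q⟫_ℝ = 0 := by
    have h1 := fderiv_inner_apply ℝ ((hr q hq').sub_const (r q₀))
      (differentiableAt_const x) (EuclideanSpace.single j 1)
    rw [hmin.fderiv_eq_zero, fderiv_sub_const] at h1
    rw [real_inner_comm]
    simpa [d1] using h1.symm
  exact ⟨q, hq', exists_eq_smul_cross (hc q hq') (hperp 0) (hperp 1)⟩

/-- On a surface of vanishing curvature, every plane through a point meets the image of every
coordinate circle about that point. -/
lemma exists_mem_sphere_inner_eq_zero {r : Plane → Space} {q₀ : Plane} {ρ : ℝ} (hρ : 0 < ρ)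
    (hr : ∀ q ∈ closedBall q₀ ρ, DifferentiableAt ℝ r q)
    (hd : ∀ q ∈ closedBall q₀ ρ, ∀ j, DifferentiableAt ℝ (d1 r j) q)
    (hc : ∀ q ∈ closedBall q₀ ρ, normal r q ≠ 0)
    (hK : ∀ q ∈ closedBall q₀ ρ, gaussianCurvature r q = 0) (N : Space) :
    ∃ q ∈ sphere q₀ ρ, ⟪r q - r q₀, N⟫_ℝ = 0 := by
  have hnpos (N : Space) : ∃ q ∈ sphere q₀ ρ, ⟪r q - r q₀, N⟫_ℝ ≤ 0 := by
    by_contra! hpos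
    obtain ⟨δ, hδ, h⟩ := exists_eq_smul_normal_of_pos_on_sphere hρ hr hc hpos
    exact (measure_ball_pos volume N hδ).ne'
      (measure_mono_null h (volume_normal_cone_eq_zero hd hc hK))
  obtain ⟨a, ha, hle⟩ := hnpos N
  obtain ⟨b, hb, hge⟩ := hnpos (-N)
  rw [inner_neg_right, neg_nonpos] at hge
  have hrank : 1 < Module.rank ℝ Plane := by
    rw [← Module.finrank_eq_rank, finrank_euclideanSpace_fin]
    norm_num
  have hcont : ContinuousOn (fun q => ⟪r q - r q₀, N⟫_ℝ) (sphere q₀ ρ) := fun q hq =>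
    (((hr q (sphere_subset_closedBall hq)).continuousAt.sub continuousAt_const).inner
      continuousAt_const).continuousWithinAt
  exact (isPreconnected_sphere hrank q₀ ρ).intermediate_value ha hb hcont ⟨hle, hge⟩

/-- A regular parametrized surface of vanishing curvature meets the tangent plane at each of its
points in further points arbitrarily close in the parameter. -/
lemma frequently_sub_mem_range_fderiv {r : Plane → Space} {U : Set Plane} (hU : IsOpen U)
    (hr : ContDiffOn ℝ 2 r U) {q₀ : Plane} (hq₀ : q₀ ∈ U)
    (hinj : Function.Injective (fderiv ℝ r q₀)) (hK : ∀ q ∈ U, gaussianCurvature r q = 0) :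
    ∃ᶠ q in 𝓝[≠] q₀, r q - r q₀ ∈ (fderiv ℝ r q₀).range := by
  have hfd : ContDiffOn ℝ 1 (fderiv ℝ r) U := hr.fderiv_of_isOpen hU (by norm_num)
  have hd (j : Fin 2) : ContDiffOn ℝ 1 (d1 r j) U := hfd.clm_apply contDiffOn_const
  have hnc : ContinuousAt (normal r) q₀ :=
    continuous_cross.continuousAt.comp (f := fun q => (d1 r 0 q, d1 r 1 q))
    (((hd 0).continuousOn.continuousAt (hU.mem_nhds hq₀)).prodMk
      ((hd 1).continuousOn.continuousAt (hU.mem_nhds hq₀)))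
  have hn0 := normal_ne_zero hinj
  obtain ⟨R, hR, hball⟩ := Metric.eventually_nhds_iff_ball.1
    ((hU.eventually_mem hq₀).and (hnc.eventually_ne hn0))
  rw [(nhdsWithin_hasBasis nhds_basis_ball _).frequently_iff]
  intro ρ hρ
  have hσ : 0 < min R ρ / 2 := by positivity
  have hlt : min R ρ / 2 < R := by linarith [min_le_left R ρ, lt_min hR hρ]
  have hlt' : min R ρ / 2 < ρ := by linarith [min_le_right R ρ, lt_min hR hρ]
  have hsub : ∀ q ∈ closedBall q₀ (min R ρ / 2), q ∈ U ∧ normal r q ≠ 0 := fun q hq =>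
    hball q (closedBall_subset_ball hlt hq)
  obtain ⟨q, hq, h0⟩ := exists_mem_sphere_inner_eq_zero hσ
    (fun q hq => (hr.differentiableOn (by norm_num)).differentiableAt
      (hU.mem_nhds (hsub q hq).1))
    (fun q hq j => ((hd j).differentiableOn (by norm_num)).differentiableAt
      (hU.mem_nhds (hsub q hq).1))
    (fun q hq => (hsub q hq).2) (fun q hq => hK q (hsub q hq).1) (normal r q₀)
  refine ⟨q, ⟨closedBall_subset_ball hlt' (sphere_subset_closedBall hq),
    ne_of_mem_sphere hq hσ.ne'⟩, ?_⟩
  rw [real_inner_comm] at h0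
  obtain ⟨s, t, hst⟩ := exists_eq_add_smul_of_inner_cross hn0 h0
  exact ⟨!₂[s, t], by
    rw [ContinuousLinearMap.coe_coe, fderiv_apply_eq, hst]; simp⟩

end Param

/-! ### Surfaces in charts -/

lemma differential_eq_fderiv_chart {M : Type*} [TopologicalSpace M] [ChartedSpace Plane M]
    {f : M → Space} {m : M} (hf : MDifferentiableAt (𝓡 2) 𝓘(ℝ, Space) f m) :
    differential f m = fderiv ℝ (f ∘ (chartAt Plane m).symm) (chartAt Plane m m) := by
  rw [differential, hf.mfderiv]
  simp only [mfld_simps, fderivWithin_univ]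
  rfl

theorem theorem1 {M : Type*} [TopologicalSpace M] [ChartedSpace Plane M] [IsManifold (𝓡 2) 2 M]
    (f : M → Space) (hf : IsDevelopable f) (m : M) (ε : ℝ) (hε : 0 < ε) :
    ∃ x₀ ∈ Set.range f, 0 < ‖f m - x₀‖ ∧ ‖f m - x₀‖ < ε ∧ x₀ ∈ tangentPlane f m := by
  set e := chartAt Plane m with he
  set r := f ∘ e.symm with hr_def
  set q₀ := e m with hq_def
  have hmem : m ∈ e.source := mem_chart_source Plane m
  have hq₀ : q₀ ∈ e.target := e.map_source hmem
  have hr₀ : r q₀ = f m := congrArg f (e.left_inv hmem)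
  have hdiff : differential f m = fderiv ℝ r q₀ :=
    differential_eq_fderiv_chart (hf.contMDiff.mdifferentiable (by norm_num) m)
  have hr : ContDiffOn ℝ 2 r e.target :=
    (hf.contMDiff.comp_contMDiffOn (contMDiffOn_chart_symm (I := 𝓡 2) (x := m))).contDiffOn
  have hinj : Function.Injective (fderiv ℝ r q₀) := hdiff ▸ hf.injective_differential m
  have hK : ∀ q ∈ e.target, Param.gaussianCurvature r q = 0 := fun q hq => by
    have h := hf.curvature_eq_zero (e.symm q) e (chart_mem_atlas Plane m) (e.map_target hq)
    rwa [gaussianCurvatureInChart, e.right_inv hq] at h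
  have hderiv : HasFDerivAt r (fderiv ℝ r q₀) q₀ :=
    ((hr.differentiableOn (by norm_num)).differentiableAt
      (e.open_target.mem_nhds hq₀)).hasFDerivAt
  have hne : ∀ᶠ q in 𝓝[≠] q₀, r q ≠ r q₀ := by
    obtain ⟨C, -, hC⟩ := (fderiv ℝ r q₀ : Plane →ₗ[ℝ] Space).exists_antilipschitzWith
      (LinearMap.ker_eq_bot.2 hinj)
    exact hderiv.eventually_ne ⟨C, hC⟩
  have hnear : ∀ᶠ q in 𝓝[≠] q₀, r q ∈ ball (r q₀) ε :=
    (hderiv.continuousAt.eventually (ball_mem_nhds _ hε)).filter_mono nhdsWithin_le_nhds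
  obtain ⟨q, hq, hq_ne, hq_near⟩ :=
    ((Param.frequently_sub_mem_range_fderiv e.open_target hr hq₀ hinj hK).and_eventually
      (hne.and hnear)).exists
  refine ⟨r q, ⟨e.symm q, rfl⟩, ?_, ?_, ?_⟩
  · rw [← hr₀]
    exact norm_pos_iff.2 (sub_ne_zero.2 hq_ne.symm)
  · rw [← hr₀, ← dist_eq_norm, dist_comm]
    exact hq_near
  · rw [tangentPlane, AffineSubspace.mem_mk', vsub_eq_sub, ← hr₀, hdiff]
    exact hq
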